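/- Let $k\in\mathbb{N}$, and let $[\mathbb{C}]^k$ be the quotient of the product space $\mathbb{C}^k$ by the equivalence relation identifying tuples that agree up to a permutation of the indices; $[c_0,\ldots,c_{k-1}]$ denotes the class of $(c_0,\ldots,c_{k-1})$. Then the map $$\mathrm{Roots}:\mathbb{C}^k\to[\mathbb{C}]^k$$ sending $(a_0,\ldots,a_{k-1})$ to the unique $[c_0,\ldots,c_{k-1}]$ such that $$x^k+\sum_{i<k}a_ix^i=\prod_{i<k}(x-c_i)$$ is well defined and computable as a map of represented spaces. Here a represented space is a set $X$ with a partial surjection from $\{0,1\}^{\mathbb{N}}$ onto $X$ (a preimage of $x$ is a name of $x$), and a map $f:X\to Y$ is computable if one oracle program transforms every name $p$ of every $x\in X$ into a name of $f(x)$, computing its bits from $p$. A real number $x$ is named by (binary codes of) sequences of rationals $(q_n)_{n\in\mathbb{N}}$ with $|q_n-x|<2^{-n}$ for all $n$; $\mathbb{C}$ is represented as $\mathbb{R}^2$, a tuple is named by interleaving names of its entries, and a name of an unordered tuple is a name of any of its arrangements. -/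

import Mathlib

/-! ### Type-2 computability on infinite binary sequences -/

/-- Infinite binary sequences. -/
abbrev BinSeq : Type := ℕ → Bool

/-- The partial recursive functionals `Φ : 2^ℕ × ℕ ⇀ ℕ`: those given by a single oracle program,
which computes `Φ p n` from `n` while reading bits of the infinite input `p`. The clauses are those
of Mathlib's `Nat.RecursiveIn`, but uniformly in the oracle `p`. -/
inductive PartrecFunctional : (BinSeq → ℕ →. ℕ) → Prop
  | zero : PartrecFunctional fun _ _ => pure 0
  | succ : PartrecFunctional fun _ => (Nat.succ : ℕ →. ℕ)
  | left : PartrecFunctional fun _ => ((fun n => (Nat.unpair n).1 : ℕ → ℕ) : ℕ →. ℕ)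
  | right : PartrecFunctional fun _ => ((fun n => (Nat.unpair n).2 : ℕ → ℕ) : ℕ →. ℕ)
  | oracle : PartrecFunctional fun p => ((fun n => (p n).toNat : ℕ → ℕ) : ℕ →. ℕ)
  | pair {Φ Ψ : BinSeq → ℕ →. ℕ} (hΦ : PartrecFunctional Φ) (hΨ : PartrecFunctional Ψ) :
      PartrecFunctional fun p n => Nat.pair <$> Φ p n <*> Ψ p n
  | comp {Φ Ψ : BinSeq → ℕ →. ℕ} (hΦ : PartrecFunctional Φ) (hΨ : PartrecFunctional Ψ) :
      PartrecFunctional fun p n => Ψ p n >>= Φ p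
  | prec {Φ Ψ : BinSeq → ℕ →. ℕ} (hΦ : PartrecFunctional Φ) (hΨ : PartrecFunctional Ψ) :
      PartrecFunctional fun p n =>
        (Nat.unpair n).2.rec (Φ p (Nat.unpair n).1) fun y IH => do
          let i ← IH
          Ψ p (Nat.pair (Nat.unpair n).1 (Nat.pair y i))
  | rfind {Φ : BinSeq → ℕ →. ℕ} (hΦ : PartrecFunctional Φ) :
      PartrecFunctional fun p a =>
        Nat.rfind fun n => (fun m => decide (m = 0)) <$> Φ p (Nat.pair a n)

/-! ### Represented spaces -/

/-- A representation of `X`: a partial surjection from the infinite binary sequences onto `X`, given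
by its graph. `names p x` says that `p` is a name (code) of `x`. -/
structure SpaceRep (X : Type*) where
  names : BinSeq → X → Prop
  unique : ∀ {p : BinSeq} {x y : X}, names p x → names p y → x = y
  surj : ∀ x : X, ∃ p : BinSeq, names p x

/-- A total map between represented spaces is computable if it has a computable realizer: one
program that turns every name `p` of every `x` into a name `q` of `f x`, computing the bits of `q`
from `p`. -/
def IsComputableMap {X Y : Type*} (δX : SpaceRep X) (δY : SpaceRep Y) (f : X → Y) :
    Prop :=
  ∃ Φ : BinSeq → ℕ →. ℕ, PartrecFunctional Φ ∧
    ∀ (p : BinSeq) (x : X), δX.names p x →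
      ∃ q : BinSeq, δY.names q (f x) ∧ ∀ n : ℕ, Φ p n = Part.some (q n).toNat

/-- The product representation on `X ^ k`: the name of a tuple interleaves names `p₀, …, pₖ₋₁` of
its entries, `p = p₀(0) p₁(0) … pₖ₋₁(0) p₀(1) p₁(1) …`. -/
def SpaceRep.pow {X : Type*} (δ : SpaceRep X) (k : ℕ) :
    SpaceRep (Fin k → X) where
  names p x := ∀ i : Fin k, δ.names (fun n => p (k * n + i)) (x i)
  unique hx hy := funext fun i => δ.unique (hx i) (hy i)
  surj x := by
    choose r hr using fun i => δ.surj (x i)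
    refine ⟨fun m => if h : 0 < k then r ⟨m % k, Nat.mod_lt m h⟩ (m / k) else false, fun i => ?_⟩
    have hk : 0 < k := i.pos
    convert hr i using 2 with n
    have h1 : (k * n + (i : ℕ)) % k = i := by
      rw [Nat.mul_add_mod, Nat.mod_eq_of_lt i.isLt]
    have h2 : (k * n + (i : ℕ)) / k = n := by
      rw [Nat.mul_add_div hk, Nat.div_eq_of_lt i.isLt, add_zero]
    simp [hk, h1, h2]

/-! ### Unordered tuples -/

/-- Two `k`-tuples are identified if they agree up to a permutation of the indices. -/
def permSetoid (X : Type*) (k : ℕ) : Setoid (Fin k → X) where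
  r x y := ∃ σ : Equiv.Perm (Fin k), ∀ i, x i = y (σ i)
  iseqv :=
    { refl := fun _ => ⟨1, fun _ => rfl⟩
      symm := fun {x y} ⟨σ, h⟩ => ⟨σ⁻¹, fun i => by simp [h]⟩
      trans := fun {x y z} ⟨σ, h⟩ ⟨τ, g⟩ => ⟨τ * σ, fun i => by simp [h, g]⟩ }

/-- The set `[X]^k` of unordered `k`-tuples of elements of `X`. -/
def UnorderedTuple (X : Type*) (k : ℕ) : Type _ := Quotient (permSetoid X k)

/-- The unordered tuple `[c₀, …, cₖ₋₁]`. -/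
def UnorderedTuple.mk {X : Type*} {k : ℕ} (c : Fin k → X) : UnorderedTuple X k :=
  Quotient.mk (permSetoid X k) c

/-- The quotient representation on `[X]^k`: a name of an unordered tuple is a name of any of its
arrangements. -/
def SpaceRep.unordered {X : Type*} (δ : SpaceRep X) (k : ℕ) :
    SpaceRep (UnorderedTuple X k) where
  names p t := ∃ c : Fin k → X, (δ.pow k).names p c ∧ UnorderedTuple.mk c = t
  unique := by
    rintro p _ _ ⟨c, hc, rfl⟩ ⟨d, hd, rfl⟩
    rw [(δ.pow k).unique hc hd]
  surj t := by
    obtain ⟨c, rfl⟩ := Quotient.exists_rep t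
    obtain ⟨p, hp⟩ := (δ.pow k).surj c
    exact ⟨p, c, hp, rfl⟩

/-! ### The real and complex numbers -/

/-- The standard numbering of the rational numbers, `⟨⟨i, j⟩, l⟩ ↦ (i - j) / (l + 1)`. -/
def ratOfNat (n : ℕ) : ℚ :=
  (((n.unpair.1.unpair.1 : ℕ) : ℚ) - ((n.unpair.1.unpair.2 : ℕ) : ℚ)) / ((n.unpair.2 : ℕ) + 1)

theorem ratOfNat_surjective : Function.Surjective ratOfNat := by
  intro q
  refine ⟨Nat.pair (Nat.pair q.num.toNat (-q.num).toNat) (q.den - 1), ?_⟩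
  have hd : ((q.den - 1 : ℕ) : ℚ) + 1 = q.den := by
    have := q.den_pos
    exact_mod_cast Nat.sub_add_cancel this
  have hn : ((q.num.toNat : ℕ) : ℚ) - (((-q.num).toNat : ℕ) : ℚ) = q.num := by
    exact_mod_cast Int.toNat_sub_toNat_neg q.num
  simp only [ratOfNat, Nat.unpair_pair]
  rw [hd, hn, Rat.num_div_den]

/-- The binary sequence `p` codes the sequence `m` of natural numbers: `p` is the characteristic
sequence of the graph of `m`. -/
def BinSeq.Codes (p : BinSeq) (m : ℕ → ℕ) : Prop :=
  ∀ i j : ℕ, p (Nat.pair i j) = true ↔ m i = j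

/-- The standard representation of the real numbers: a name of `x` codes a sequence of rational
numbers `qₙ` with `|qₙ - x| < 2⁻ⁿ` for all `n`. -/
def realRep : SpaceRep ℝ where
  names p x := ∃ m : ℕ → ℕ, BinSeq.Codes p m ∧
    ∀ n : ℕ, |((ratOfNat (m n) : ℚ) : ℝ) - x| < (1 / 2 : ℝ) ^ n
  unique := by
    rintro p x y ⟨m, hm, hx⟩ ⟨m', hm', hy⟩
    have hmm : m = m' := funext fun i => ((hm' i (m i)).1 ((hm i (m i)).2 rfl)).symm
    subst hmm
    by_contra hne
    obtain ⟨n, hn⟩ := exists_pow_lt_of_lt_one (half_pos (abs_pos.2 (sub_ne_zero.2 hne)))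
      (by norm_num : (1 / 2 : ℝ) < 1)
    have h := abs_sub_le x (ratOfNat (m n) : ℝ) y
    rw [abs_sub_comm x (ratOfNat (m n) : ℝ)] at h
    linarith [hx n, hy n]
  surj x := by
    have h : ∀ n : ℕ, ∃ m : ℕ, |((ratOfNat m : ℚ) : ℝ) - x| < (1 / 2 : ℝ) ^ n := by
      intro n
      obtain ⟨q, hq⟩ := exists_rat_near x (by positivity : (0 : ℝ) < (1 / 2 : ℝ) ^ n)
      obtain ⟨m, rfl⟩ := ratOfNat_surjective q
      exact ⟨m, by rwa [abs_sub_comm]⟩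
    choose m hm using h
    exact ⟨fun t => decide (m t.unpair.1 = t.unpair.2), m, fun i j => by simp, hm⟩

/-- The standard representation of the complex numbers, identified with `ℝ²`. -/
def complexRep : SpaceRep ℂ where
  names p z := (realRep.pow 2).names p ![z.re, z.im]
  unique h h' := by
    have e := (realRep.pow 2).unique h h'
    exact Complex.ext (by simpa using congrFun e 0) (by simpa using congrFun e 1)
  surj z := (realRep.pow 2).surj _

/-! ### Partial recursive functionals -/

/-! The unordered roots depend on the coefficients with an explicit modulus of continuity:
`exists_perm_norm_sub_le_of_coeff` gives, for each degree, a constant `M` such that coefficients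
agreeing up to `2^(-M(n+b+1))` force the roots to match up to `2^(-n)` after a permutation, where
`2^b` bounds the data.

The program builds Gaussian rational tuples one after another. Each step searches for a bound,
coefficient approximations read off the name, and a tuple whose product polynomial nearly has these
coefficients and whose entries are close to those of the previous tuple. All tests are strict
rational inequalities or oracle queries, hence decidable. The search succeeds because some
arrangement of the true roots passes the strict tests, hence so do rational tuples near it
(`exists_rootTest`). Any tuple found is again close to an arrangement of the roots
(`exists_rootTest_sound`), so the search never gets stuck.

That arrangement may change from step to step. Closeness of consecutive tuples still makes each
entry converge, and continuity of the coefficients shows that the limit is an arrangement of the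
roots. The ordering is thus settled by the search, and this is why the output is only an unordered
tuple. -/

theorem PartrecFunctional.of_partrec {f : ℕ →. ℕ} (hf : Nat.Partrec f) :
    PartrecFunctional fun _ => f := by
  induction hf with
  | zero => exact .zero
  | succ => exact .succ
  | left => exact .left
  | right => exact .right
  | pair _ _ hf hg => exact .pair hf hg
  | comp _ _ hf hg => exact .comp hf hg
  | prec _ _ hf hg => exact .prec hf hg
  | rfind _ hf => exact .rfind hf

/-- Total functionals `2^ℕ × ℕ → ℕ` given by a single oracle program. -/
def ComputableFunctional (f : BinSeq → ℕ → ℕ) : Prop :=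
  PartrecFunctional fun p n => Part.some (f p n)

theorem ComputableFunctional.of_primrec {f : ℕ → ℕ} (hf : Primrec f) :
    ComputableFunctional fun _ => f :=
  .of_partrec (Nat.Partrec.of_primrec (Primrec.nat_iff.1 hf))

theorem ComputableFunctional.pair {f g : BinSeq → ℕ → ℕ} (hf : ComputableFunctional f)
    (hg : ComputableFunctional g) : ComputableFunctional fun p n => Nat.pair (f p n) (g p n) := by
  have h := PartrecFunctional.pair hf hg
  simpa [ComputableFunctional, Seq.seq] using h

theorem ComputableFunctional.comp {f g : BinSeq → ℕ → ℕ} (hf : ComputableFunctional f)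
    (hg : ComputableFunctional g) : ComputableFunctional fun p n => f p (g p n) := by
  have h := PartrecFunctional.comp hf hg
  simpa [ComputableFunctional] using h

theorem ComputableFunctional.comp₂ {f g : BinSeq → ℕ → ℕ} {h : ℕ → ℕ → ℕ} (hh : Primrec₂ h)
    (hf : ComputableFunctional f) (hg : ComputableFunctional g) :
    ComputableFunctional fun p n => h (f p n) (g p n) := by
  have := (ComputableFunctional.of_primrec (Primrec.nat_iff.2 (Primrec₂.unpaired'.2 hh))).comp
    (hf.pair hg)
  simpa [Nat.unpaired] using this

/-- Predicates on `2^ℕ × ℕ` decided by a single oracle program. -/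
def DecidableFunctional (P : BinSeq → ℕ → Prop) : Prop :=
  ∃ f, ComputableFunctional f ∧ ∀ p n, f p n = 0 ↔ P p n

namespace DecidableFunctional

theorem of_primrecPred {P : ℕ → Prop} (hP : PrimrecPred P) : DecidableFunctional fun _ => P := by
  obtain ⟨_, h⟩ := id hP
  exact ⟨_, .of_primrec (Primrec.ite hP (Primrec.const 0) (Primrec.const 1)), fun p n => by simp⟩

theorem and {P Q : BinSeq → ℕ → Prop} (hP : DecidableFunctional P) (hQ : DecidableFunctional Q) :
    DecidableFunctional fun p n => P p n ∧ Q p n := by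
  obtain ⟨f, hf, hfP⟩ := hP
  obtain ⟨g, hg, hgQ⟩ := hQ
  exact ⟨_, .comp₂ Primrec.nat_add hf hg, fun p n => by simp [← hfP, ← hgQ]⟩

/-- The index set is fixed in advance, so the quantifier unrolls into finitely many tests and needs
no uniformity in `i`. -/
theorem forall_mem {ι : Type*} (s : Finset ι) {P : ι → BinSeq → ℕ → Prop}
    (hP : ∀ i, DecidableFunctional (P i)) :
    DecidableFunctional fun p n => ∀ i ∈ s, P i p n := by
  classical
  induction s using Finset.induction_on with
  | empty => exact ⟨_, .of_primrec (Primrec.const 0), by simp⟩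
  | insert a s ha ih => simpa using (hP a).and ih

theorem forall_fintype {ι : Type*} [Fintype ι] {P : ι → BinSeq → ℕ → Prop}
    (hP : ∀ i, DecidableFunctional (P i)) : DecidableFunctional fun p n => ∀ i, P i p n := by
  simpa using forall_mem Finset.univ hP

theorem oracle {g : ℕ → ℕ} (hg : Primrec g) :
    DecidableFunctional fun p n => p (g n) = true := by
  have h : ComputableFunctional fun p n => (p n).toNat := PartrecFunctional.oracle
  refine ⟨_, .comp₂ Primrec.nat_sub (.of_primrec (Primrec.const 1))
    (h.comp (.of_primrec hg)), fun p n => ?_⟩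
  cases h : p (g n) <;> simp [h]

theorem exists_search {P : BinSeq → ℕ → Prop} (hP : DecidableFunctional P) :
    ∃ Φ, PartrecFunctional Φ ∧ ∀ p a, (∃ w, P p (Nat.pair a w)) →
      ∃ w, P p (Nat.pair a w) ∧ Φ p a = Part.some w := by
  obtain ⟨f, hf, hfP⟩ := hP
  refine ⟨_, PartrecFunctional.rfind hf, fun p a ⟨w, hw⟩ => ?_⟩
  obtain ⟨v, hv, -⟩ := Nat.rfind_min' (p := fun n => decide (f p (Nat.pair a n) = 0)) (m := w)
    (by simpa [hfP] using hw)
  have hv' := Nat.rfind_spec hv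
  refine ⟨v, by simpa [hfP] using hv', ?_⟩
  rw [Part.eq_some_iff]
  simp only [Part.map_eq_map, Part.map_some]
  exact hv

/-- A sequence `s` is computed from `p` by searching, given `s n`, for a `w` with
`P p ⟨⟨n, s n⟩, w⟩` and letting `s (n + 1) = g w`. -/
theorem exists_sequence {P : BinSeq → ℕ → Prop} (hP : DecidableFunctional P) {g : ℕ → ℕ}
    (hg : Primrec g) :
    ∃ Φ, PartrecFunctional Φ ∧ ∀ (p : BinSeq) (I : ℕ → ℕ → Prop), I 0 0 →
      (∀ n c, I n c → ∃ w, P p (Nat.pair (Nat.pair n c) w)) →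
      (∀ n c w, I n c → P p (Nat.pair (Nat.pair n c) w) → I (n + 1) (g w)) →
      ∃ s : ℕ → ℕ, (∀ n, Φ p n = Part.some (s n)) ∧
        ∀ n, ∃ w, P p (Nat.pair (Nat.pair n (s n)) w) ∧ s (n + 1) = g w := by
  obtain ⟨Ψ, hΨ, hs⟩ := hP.exists_search
  have hg' : ComputableFunctional fun _ => g := .of_primrec hg
  -- `prec` carries a parameter, here a dummy `0`: `.right` discards it in the recursion step, and
  -- `hpre` supplies it at the start.
  have hstep := PartrecFunctional.comp hg' (hΨ.comp .right)
  have hseq := PartrecFunctional.prec .zero hstep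
  have hpre : ComputableFunctional fun _ n => Nat.pair 0 n :=
    .of_primrec (Primrec₂.natPair.comp (Primrec.const 0) Primrec.id)
  refine ⟨_, hseq.comp hpre, fun p I h0 hex hI => ?_⟩
  choose! w hw hΦ using fun n c (h : I n c) => hs p _ (hex n c h)
  -- The invariant `I` only guarantees that each search halts; the program never evaluates it.
  let s : ℕ → ℕ := fun n => Nat.rec 0 (fun n c => g (w n c)) n
  have hIs : ∀ n, I n (s n) := by
    intro n
    induction n with
    | zero => exact h0
    | succ n ih => exact hI n _ _ ih (hw n _ ih)
  refine ⟨s, fun n => ?_, fun n => ⟨_, hw n _ (hIs n), rfl⟩⟩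
  simp only [Part.bind_eq_bind, Part.bind_some, Nat.unpair_pair, PFun.coe_val]
  induction n with
  | zero => rfl
  | succ n ih =>
    have e : (Part.some (Nat.pair n (s n)) >>= Ψ p) = Part.some (w n (s n)) :=
      (Part.bind_some _ _).trans (hΦ n _ (hIs n))
    simp only [ih, Part.bind_some, e]
    rfl

end DecidableFunctional

/-! ### Primitive recursive sequences of rational and Gaussian rational numbers -/

/-- A sequence of rational numbers, as real numbers, whose codes are primitive recursive. -/
def PrimrecReal (f : ℕ → ℝ) : Prop :=
  ∃ g : ℕ → ℕ, Primrec g ∧ ∀ n, f n = ((ratOfNat (g n) : ℚ) : ℝ)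

namespace PrimrecReal

theorem unpair_fst {g : ℕ → ℕ} (hg : Primrec g) : Primrec fun n => (g n).unpair.1 :=
  Primrec.fst.comp (Primrec.unpair.comp hg)

theorem unpair_snd {g : ℕ → ℕ} (hg : Primrec g) : Primrec fun n => (g n).unpair.2 :=
  Primrec.snd.comp (Primrec.unpair.comp hg)

/-- Splitting a code into numerator parts and denominator minus one reduces rational arithmetic to
polynomial arithmetic on `ℕ`. -/
theorem exists_fraction {f : ℕ → ℝ} (hf : PrimrecReal f) :
    ∃ a b d : ℕ → ℕ, Primrec a ∧ Primrec b ∧ Primrec d ∧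
      ∀ n, f n = ((a n : ℝ) - b n) / (d n + 1) := by
  obtain ⟨g, hg, h⟩ := hf
  refine ⟨_, _, _, unpair_fst (unpair_fst hg), unpair_snd (unpair_fst hg), unpair_snd hg,
    fun n => ?_⟩
  rw [h, ratOfNat]
  push_cast
  rfl

theorem of_fraction {f : ℕ → ℝ} {a b d : ℕ → ℕ} (ha : Primrec a) (hb : Primrec b)
    (hd : Primrec d) (h : ∀ n, f n = ((a n : ℝ) - b n) / (d n + 1)) : PrimrecReal f := by
  refine ⟨_, Primrec₂.natPair.comp (Primrec₂.natPair.comp ha hb) hd, fun n => ?_⟩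
  rw [h, ratOfNat]
  push_cast
  simp only [Nat.unpair_pair]

theorem ratOfNat_comp {g : ℕ → ℕ} (hg : Primrec g) :
    PrimrecReal fun n => ((ratOfNat (g n) : ℚ) : ℝ) :=
  ⟨g, hg, fun _ => rfl⟩

theorem natCast {g : ℕ → ℕ} (hg : Primrec g) : PrimrecReal fun n => (g n : ℝ) :=
  of_fraction hg (Primrec.const 0) (Primrec.const 0) fun n => by simp

theorem half_pow {g : ℕ → ℕ} (hg : Primrec g) : PrimrecReal fun n => (1 / 2 : ℝ) ^ g n := by
  have h2 : Primrec fun n : ℕ => 2 ^ n - 1 := by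
    refine Primrec.nat_sub.comp ?_ (Primrec.const 1)
    refine (Primrec.nat_rec₁ 1 (Primrec.nat_mul.comp₂ Primrec₂.right (Primrec₂.const 2))).of_eq
      fun n => ?_
    induction n with
    | zero => rfl
    | succ n ih => simpa [pow_succ] using ih
  refine of_fraction (Primrec.const 1) (Primrec.const 0) (h2.comp hg) fun n => ?_
  rw [Nat.cast_sub Nat.one_le_two_pow]
  simp

theorem neg {f : ℕ → ℝ} (hf : PrimrecReal f) : PrimrecReal fun n => -f n := by
  obtain ⟨a, b, d, ha, hb, hd, h⟩ := hf.exists_fraction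
  exact of_fraction hb ha hd fun n => by rw [h]; ring

theorem add {f g : ℕ → ℝ} (hf : PrimrecReal f) (hg : PrimrecReal g) :
    PrimrecReal fun n => f n + g n := by
  obtain ⟨a, b, d, ha, hb, hd, h⟩ := hf.exists_fraction
  obtain ⟨a', b', d', ha', hb', hd', h'⟩ := hg.exists_fraction
  have m {u v : ℕ → ℕ} (hu : Primrec u) (hv : Primrec v) : Primrec fun n => u n * v n :=
    Primrec.nat_mul.comp hu hv
  have s {u v : ℕ → ℕ} (hu : Primrec u) (hv : Primrec v) : Primrec fun n => u n + v n :=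
    Primrec.nat_add.comp hu hv
  refine of_fraction (s (m ha (s hd' (.const 1))) (m ha' (s hd (.const 1))))
    (s (m hb (s hd' (.const 1))) (m hb' (s hd (.const 1)))) (s (m hd hd') (s hd hd')) fun n => ?_
  rw [h, h']
  push_cast
  have e : (d n : ℝ) * d' n + (d n + d' n) + 1 = (d n + 1) * (d' n + 1) := by ring
  rw [e]
  field_simp
  ring

theorem mul {f g : ℕ → ℝ} (hf : PrimrecReal f) (hg : PrimrecReal g) :
    PrimrecReal fun n => f n * g n := by
  obtain ⟨a, b, d, ha, hb, hd, h⟩ := hf.exists_fraction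
  obtain ⟨a', b', d', ha', hb', hd', h'⟩ := hg.exists_fraction
  have m {u v : ℕ → ℕ} (hu : Primrec u) (hv : Primrec v) : Primrec fun n => u n * v n :=
    Primrec.nat_mul.comp hu hv
  have s {u v : ℕ → ℕ} (hu : Primrec u) (hv : Primrec v) : Primrec fun n => u n + v n :=
    Primrec.nat_add.comp hu hv
  refine of_fraction (s (m ha ha') (m hb hb')) (s (m ha hb') (m hb ha'))
    (s (m hd hd') (s hd hd')) fun n => ?_
  rw [h, h']
  push_cast
  have e : (d n : ℝ) * d' n + (d n + d' n) + 1 = (d n + 1) * (d' n + 1) := by ring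
  rw [e]
  field_simp
  ring

theorem sub {f g : ℕ → ℝ} (hf : PrimrecReal f) (hg : PrimrecReal g) :
    PrimrecReal fun n => f n - g n := by
  simpa only [sub_eq_add_neg] using hf.add hg.neg

theorem primrecPred_lt {f g : ℕ → ℝ} (hf : PrimrecReal f) (hg : PrimrecReal g) :
    PrimrecPred fun n => f n < g n := by
  obtain ⟨a, b, d, ha, hb, hd, h⟩ := (hg.sub hf).exists_fraction
  refine (Primrec.nat_lt.comp hb ha).of_eq fun n => ?_
  rw [← sub_pos (b := f n), h, div_pos_iff_of_pos_right (by positivity), sub_pos, Nat.cast_lt]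

theorem primrecPred_abs_lt {f g : ℕ → ℝ} (hf : PrimrecReal f) (hg : PrimrecReal g) :
    PrimrecPred fun n => |f n| < g n :=
  ((hg.neg.primrecPred_lt hf).and (hf.primrecPred_lt hg)).of_eq fun _ => abs_lt.symm

end PrimrecReal

/-- A sequence of Gaussian rational numbers whose codes are primitive recursive. -/
def PrimrecComplex (f : ℕ → ℂ) : Prop :=
  (PrimrecReal fun n => (f n).re) ∧ PrimrecReal fun n => (f n).im

namespace PrimrecComplex

theorem natCast {g : ℕ → ℕ} (hg : Primrec g) : PrimrecComplex fun n => (g n : ℂ) :=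
  ⟨by simpa using PrimrecReal.natCast hg, by simpa using PrimrecReal.natCast (Primrec.const 0)⟩

theorem sub {f g : ℕ → ℂ} (hf : PrimrecComplex f) (hg : PrimrecComplex g) :
    PrimrecComplex fun n => f n - g n :=
  ⟨hf.1.sub hg.1, hf.2.sub hg.2⟩

theorem mul {f g : ℕ → ℂ} (hf : PrimrecComplex f) (hg : PrimrecComplex g) :
    PrimrecComplex fun n => f n * g n :=
  ⟨by simpa using (hf.1.mul hg.1).sub (hf.2.mul hg.2),
    by simpa using (hf.1.mul hg.2).add (hf.2.mul hg.1)⟩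

open Polynomial in
theorem coeff_prod_X_sub_C {ι : Type*} (s : Finset ι) {c : ℕ → ι → ℂ}
    (hc : ∀ i, PrimrecComplex fun n => c n i) (j : ℕ) :
    PrimrecComplex fun n => (∏ i ∈ s, (X - C (c n i))).coeff j := by
  classical
  induction s using Finset.induction_on generalizing j with
  | empty =>
    simpa [coeff_one] using natCast (Primrec.const (if j = 0 then 1 else 0))
  | insert a s ha ih =>
    have h0 := natCast (Primrec.const 0)
    rcases j with _ | j
    · simpa [Finset.prod_insert ha, sub_mul] using h0.sub ((hc a).mul (ih 0))
    · simpa [Finset.prod_insert ha, sub_mul] using (ih j).sub ((hc a).mul (ih (j + 1)))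

end PrimrecComplex

open Polynomial in
theorem continuous_coeff_prod_X_sub_C {ι : Type*} (s : Finset ι) (j : ℕ) :
    Continuous fun c : ι → ℂ => (∏ i ∈ s, (X - C (c i))).coeff j := by
  classical
  induction s using Finset.induction_on generalizing j with
  | empty => simpa using continuous_const
  | insert a s ha ih =>
    rcases j with _ | j
    · simpa [Finset.prod_insert ha, sub_mul, Pi.mul_def, Pi.neg_def] using
        ((continuous_apply a).mul (ih 0)).neg
    · simpa [Finset.prod_insert ha, sub_mul, Pi.mul_def, Pi.sub_def] using
        (ih j).sub ((continuous_apply a).mul (ih (j + 1)))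

/-! ### Natural numbers as codes of sequences -/

/-- The `i`-th entry of the sequence coded by `z`. -/
def natEntry (z i : ℕ) : ℕ := ((fun m => m.unpair.2)^[i] z).unpair.1

theorem exists_natEntry_eq (n : ℕ) (f : ℕ → ℕ) : ∃ z, ∀ i < n, natEntry z i = f i := by
  induction n generalizing f with
  | zero => exact ⟨0, by simp⟩
  | succ n ih =>
    obtain ⟨z, hz⟩ := ih fun i => f (i + 1)
    refine ⟨Nat.pair (f 0) z, fun i hi => ?_⟩
    rcases i with _ | i
    · simp [natEntry]
    · simpa [natEntry] using hz i (by omega)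

theorem primrec_natEntry {f g : ℕ → ℕ} (hf : Primrec f) (hg : Primrec g) :
    Primrec fun n => natEntry (f n) (g n) :=
  PrimrecReal.unpair_fst
    (Primrec.nat_iterate hg hf (PrimrecReal.unpair_snd Primrec.id |>.comp₂ Primrec₂.right))

/-- The `i`-th entry of the sequence of Gaussian rational numbers coded by `z`. -/
noncomputable def gaussEntry (z i : ℕ) : ℂ :=
  ⟨(ratOfNat (natEntry z (2 * i)) : ℚ), (ratOfNat (natEntry z (2 * i + 1)) : ℚ)⟩

theorem primrecComplex_gaussEntry {f : ℕ → ℕ} (hf : Primrec f) (i : ℕ) :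
    PrimrecComplex fun n => gaussEntry (f n) i :=
  ⟨.ratOfNat_comp (primrec_natEntry hf (Primrec.const _)),
    .ratOfNat_comp (primrec_natEntry hf (Primrec.const _))⟩

theorem exists_natEntry_pair_eq {k : ℕ} (f : Fin k → ℕ × ℕ) :
    ∃ z, ∀ i : Fin k, natEntry z (2 * i) = (f i).1 ∧ natEntry z (2 * i + 1) = (f i).2 := by
  obtain ⟨z, hz⟩ := exists_natEntry_eq (2 * k) fun l =>
    if h : l / 2 < k then (if l % 2 = 0 then (f ⟨l / 2, h⟩).1 else (f ⟨l / 2, h⟩).2) else 0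
  refine ⟨z, fun i => ?_⟩
  have h0 := hz (2 * i) (by omega)
  have h1 := hz (2 * i + 1) (by omega)
  have e : (2 * (i : ℕ) + 1) / 2 = i := by omega
  have e' : (2 * (i : ℕ) + 1) % 2 = 1 := by omega
  simp [e, e'] at h0 h1
  exact ⟨h0, h1⟩

theorem denseRange_gaussEntry (k : ℕ) :
    DenseRange fun z => fun i : Fin k => gaussEntry z i := by
  have hq : DenseRange fun n => ((ratOfNat n : ℚ) : ℝ) :=
    Rat.denseRange_cast.comp ratOfNat_surjective.denseRange Rat.continuous_coe_real
  have hc : DenseRange fun n : ℕ × ℕ => (⟨(ratOfNat n.1 : ℚ), (ratOfNat n.2 : ℚ)⟩ : ℂ) :=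
    Complex.equivRealProdCLM.symm.surjective.denseRange.comp (hq.prodMap hq)
      Complex.equivRealProdCLM.symm.continuous
  have hp := DenseRange.piMap fun _ : Fin k => hc
  refine hp.mono ?_
  rintro _ ⟨f, rfl⟩
  obtain ⟨z, hz⟩ := exists_natEntry_pair_eq f
  exact ⟨z, funext fun i => by simp [gaussEntry, hz i]⟩

/-! ### Uniform continuity of the roots of a polynomial -/

open Polynomial in
-- Equal products have equal multisets of roots, so `r` and `c` have equinumerous fibres over every
-- point; bijections between the fibres glue to a permutation.
theorem prod_X_sub_C_eq_iff {k : ℕ} (r c : Fin k → ℂ) :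
    ∏ i, (X - C (r i)) = ∏ i, (X - C (c i)) ↔ ∃ σ : Equiv.Perm (Fin k), ∀ i, r i = c (σ i) := by
  classical
  constructor
  · intro h
    have hroots (d : Fin k → ℂ) : (∏ i, (X - C (d i))).roots = Finset.univ.val.map d := by
      rw [← roots_multiset_prod_X_sub_C (Finset.univ.val.map d), Multiset.map_map]
      rfl
    have hm : Finset.univ.val.map r = Finset.univ.val.map c := by rw [← hroots, ← hroots, h]
    have hcard (z : ℂ) : Fintype.card {i // r i = z} = Fintype.card {i // c i = z} := by
      have hz := congrArg (Multiset.count z) hm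
      rw [Multiset.count_map, Multiset.count_map] at hz
      rw [Fintype.card_subtype, Fintype.card_subtype]
      simpa [Finset.card_def, eq_comm] using hz
    exact ⟨Equiv.ofFiberEquiv fun z => Fintype.equivOfCardEq (hcard z),
      fun i => (Equiv.ofFiberEquiv_map _ i).symm⟩
  · rintro ⟨σ, h⟩
    simp_rw [h]
    exact Equiv.prod_comp σ fun i => X - C (c i)

/-- Induction on the degree: match one root, divide out its linear factor, and recurse. Closeness is
measured on the circle of radius `2 ^ b`, where dividing by `x - r 0` costs nothing; the maximum
principle carries it inside to `r 0`. -/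
theorem exists_perm_norm_sub_le (k : ℕ) :
    ∃ M : ℕ, ∀ (b n : ℕ) (r c : Fin k → ℂ), (∀ i, ‖r i‖ ≤ 2 ^ b - 1) → (∀ i, ‖c i‖ ≤ 2 ^ b - 1) →
      (∀ x : ℂ, ‖x‖ = 2 ^ b →
        ‖∏ i, (x - r i) - ∏ i, (x - c i)‖ ≤ (1 / 2 : ℝ) ^ (M * (n + b + 1))) →
      ∃ σ : Equiv.Perm (Fin k), ∀ i, ‖r (σ i) - c i‖ ≤ (1 / 2 : ℝ) ^ n := by
  induction k with
  | zero => exact ⟨0, fun _ _ _ _ _ _ _ => ⟨1, fun i => i.elim0⟩⟩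
  | succ k ih =>
    obtain ⟨M, hM⟩ := ih
    refine ⟨(k + 1) * (M + k + 1), fun b n r c hr hc h => ?_⟩
    -- `t` is the distance at which the first root is matched. The factor `k + 1` in the constant
    -- pays for a `(k + 1)`-st root, and the summand `k + 1` here for the loss `2 ^ ((b + 1) * k +
    -- 1)` in the division.
    set m := (M + k + 1) * (n + b + 1) with hm
    set t : ℝ := (1 / 2) ^ m with ht
    have ht0 : 0 < t := by positivity
    have hε : (1 / 2 : ℝ) ^ ((k + 1) * (M + k + 1) * (n + b + 1)) = t ^ (k + 1) := by
      rw [ht, ← pow_mul, hm]; congr 1; ring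
    have hεt : t ^ (k + 1) ≤ t :=
      pow_le_of_le_one ht0.le (pow_le_one₀ (by norm_num) (by norm_num)) (by omega)
    rw [hε] at h
    have hroot : ‖∏ i, (r 0 - c i)‖ ≤ t ^ (k + 1) := by
      have h2b : (2 : ℝ) ^ b ≠ 0 := by positivity
      have hd : Differentiable ℂ fun x : ℂ => ∏ i, (x - r i) - ∏ i, (x - c i) := by fun_prop
      have := Complex.norm_le_of_forall_mem_frontier_norm_le (U := Metric.ball (0 : ℂ) (2 ^ b))
        Metric.isBounded_ball hd.diffContOnCl (C := t ^ (k + 1))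
        (fun z hz => h z (by rw [frontier_ball _ h2b] at hz; simpa using hz)) (z := r 0)
        (subset_closure (by simpa using (hr 0).trans_lt (by linarith)))
      simpa [Fin.prod_univ_succ] using this
    -- Not all `k + 1` factors of a product bounded by `t ^ (k + 1)` can exceed `t`.
    obtain ⟨j, hj⟩ : ∃ j, ‖r 0 - c j‖ ≤ t := by
      by_contra! hlt
      have := Finset.prod_lt_prod_of_nonempty (s := (Finset.univ : Finset (Fin (k + 1))))
        (fun _ _ => ht0) (fun i _ => hlt i) Finset.univ_nonempty
      rw [Finset.prod_const, Finset.card_univ, Fintype.card_fin, ← norm_prod] at this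
      linarith
    set d : Fin (k + 1) → ℂ := fun i => c (Equiv.swap 0 j i) with hd
    have hd0 : ‖r 0 - d 0‖ ≤ t := by simpa [hd] using hj
    have hdn (i) : ‖d i‖ ≤ 2 ^ b - 1 := hc _
    have hdprod (x : ℂ) : ∏ i, (x - c i) = ∏ i, (x - d i) :=
      (Equiv.prod_comp (Equiv.swap 0 j) fun i => x - c i).symm
    obtain ⟨σ, hσ⟩ := hM b n (fun i => r i.succ) (fun i => d i.succ) (fun i => hr _)
      (fun i => hdn _) fun x hx => by
        have h1 : 1 ≤ ‖x - r 0‖ := by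
          have := norm_sub_norm_le x (r 0)
          linarith [hr 0]
        have hQ : ‖∏ i : Fin k, (x - d i.succ)‖ ≤ 2 ^ ((b + 1) * k) := by
          rw [norm_prod, pow_mul]
          refine (Finset.prod_le_prod (g := fun _ => 2 ^ (b + 1)) (fun _ _ => norm_nonneg _)
            fun i _ => ?_).trans_eq (by simp)
          refine (norm_sub_le _ _).trans ?_
          rw [pow_succ]
          linarith [hdn i.succ]
        have hPQ := h x hx
        rw [hdprod, Fin.prod_univ_succ, Fin.prod_univ_succ] at hPQ
        set A := ∏ i : Fin k, (x - r i.succ)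
        set B := ∏ i : Fin k, (x - d i.succ)
        have e : (x - r 0) * (A - B) = ((x - r 0) * A - (x - d 0) * B) + (r 0 - d 0) * B := by ring
        calc ‖A - B‖ ≤ ‖x - r 0‖ * ‖A - B‖ := le_mul_of_one_le_left (norm_nonneg _) h1
          _ = ‖((x - r 0) * A - (x - d 0) * B) + (r 0 - d 0) * B‖ := by rw [← norm_mul, e]
          _ ≤ t ^ (k + 1) + t * 2 ^ ((b + 1) * k) := by
            refine (norm_add_le _ _).trans (add_le_add hPQ ?_)
            rw [norm_mul]
            exact mul_le_mul hd0 hQ (norm_nonneg _) ht0.le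
          _ ≤ t * 2 ^ ((b + 1) * k + 1) := by
            have : (1 : ℝ) ≤ 2 ^ ((b + 1) * k) := one_le_pow₀ (by norm_num)
            rw [pow_succ (2 : ℝ)]
            nlinarith
          _ ≤ (1 / 2) ^ (M * (n + b + 1) + ((b + 1) * k + 1)) * 2 ^ ((b + 1) * k + 1) := by
            refine mul_le_mul_of_nonneg_right
              (pow_le_pow_of_le_one (by norm_num) (by norm_num) ?_) (by positivity)
            rw [hm]
            nlinarith [Nat.zero_le (k * n)]
          _ = (1 / 2) ^ (M * (n + b + 1)) := by
            rw [pow_add, mul_assoc, ← mul_pow]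
            norm_num
    -- The left factor fixes `0` and acts as `σ` on successors; the swap undoes the relabelling from
    -- `c` to `d`.
    refine ⟨Equiv.Perm.decomposeFin.symm (0, σ) * Equiv.swap 0 j, fun i => ?_⟩
    obtain ⟨i, rfl⟩ := (Equiv.swap 0 j).surjective i
    rw [Equiv.Perm.mul_apply, Equiv.swap_apply_self]
    change ‖_ - d i‖ ≤ _
    have htn : t ≤ (1 / 2) ^ n := pow_le_pow_of_le_one (by norm_num) (by norm_num) (by
      rw [hm]; nlinarith [Nat.zero_le ((M + k) * (n + b + 1))])
    refine Fin.cases ?_ (fun i => ?_) i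
    · simpa using hd0.trans htn
    · simpa using hσ i

open Polynomial in
theorem coeff_X_pow_add_sum {k : ℕ} (a : Fin k → ℂ) (j : Fin k) :
    (X ^ k + ∑ i : Fin k, C (a i) * X ^ (i : ℕ) : ℂ[X]).coeff j = a j := by
  have hj : (j : ℕ) ≠ k := j.isLt.ne
  simp [coeff_X_pow, hj, Fin.val_inj]

open Polynomial in
theorem eval_prod_X_sub_C_eq {k : ℕ} (c : Fin k → ℂ) (x : ℂ) :
    ∏ i, (x - c i) = x ^ k + ∑ j : Fin k, (∏ i, (X - C (c i))).coeff j * x ^ (j : ℕ) := by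
  have hmonic : (∏ i, (X - C (c i))).Monic := monic_prod_of_monic _ _ fun i _ => monic_X_sub_C _
  have hdeg : (∏ i, (X - C (c i))).natDegree = k := by simp
  have := congrArg (eval x) hmonic.as_sum
  rw [hdeg, Finset.sum_range] at this
  simpa [eval_prod, eval_finsetSum] using this

open Polynomial in
theorem norm_root_le {k : ℕ} {a r : Fin k → ℂ}
    (h : X ^ k + ∑ i : Fin k, C (a i) * X ^ (i : ℕ) = ∏ i, (X - C (r i))) {R : ℝ} (hR : 0 ≤ R)
    (ha : ∀ i, ‖a i‖ ≤ R) (i : Fin k) : ‖r i‖ ≤ R + 1 := by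
  have hmonic : (∏ i, (X - C (r i))).Monic := monic_prod_of_monic _ _ fun i _ => monic_X_sub_C _
  have hroot : (∏ i, (X - C (r i))).IsRoot (r i) := by
    rw [IsRoot, eval_prod]
    exact Finset.prod_eq_zero (Finset.mem_univ i) (by simp)
  have hb := hroot.norm_lt_cauchyBound hmonic.ne_zero
  lift R to NNReal using hR
  have hcb : cauchyBound (∏ i, (X - C (r i))) ≤ R + 1 := by
    rw [cauchyBound, hmonic.leadingCoeff]
    simp only [nnnorm_one, div_one, add_le_add_iff_right]
    refine Finset.sup_le fun j hj => ?_
    have hjk : j < k := by simpa using hj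
    have := coeff_X_pow_add_sum a ⟨j, hjk⟩
    rw [h] at this
    rw [this]
    exact ha _
  exact_mod_cast (hb.trans_le hcb).le

open Polynomial in
theorem exists_perm_norm_sub_le_of_coeff (k : ℕ) :
    ∃ M : ℕ, ∀ (b n : ℕ) (a r c : Fin k → ℂ),
      X ^ k + ∑ i : Fin k, C (a i) * X ^ (i : ℕ) = ∏ i, (X - C (r i)) →
      (∀ i, ‖a i‖ ≤ 2 ^ b - 2) → (∀ i, ‖c i‖ ≤ 2 ^ b - 1) →
      (∀ j : Fin k, ‖(∏ i, (X - C (c i))).coeff j - a j‖ ≤ (1 / 2 : ℝ) ^ (M * (n + b + 1))) →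
      ∃ σ : Equiv.Perm (Fin k), ∀ i, ‖r (σ i) - c i‖ ≤ (1 / 2 : ℝ) ^ n := by
  obtain ⟨M, hM⟩ := exists_perm_norm_sub_le k
  -- The extra `k * (n + b + 1)` absorbs `k` error terms, each enlarged by at most `(2 ^ b) ^ k` on
  -- the circle, using `k ≤ 2 ^ k`.
  refine ⟨M + k, fun b n a r c h ha hc hcoeff => ?_⟩
  refine hM b n r c (fun i => ?_) hc fun x hx => ?_
  · have := norm_root_le h ((norm_nonneg _).trans (ha i)) ha i
    linarith
  rw [eval_prod_X_sub_C_eq, eval_prod_X_sub_C_eq, add_sub_add_left_eq_sub, ← h,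
    ← Finset.sum_sub_distrib]
  have hb : (1 : ℝ) ≤ 2 ^ b := one_le_pow₀ (by norm_num)
  calc _ ≤ ∑ _j : Fin k, (1 / 2 : ℝ) ^ ((M + k) * (n + b + 1)) * (2 ^ b) ^ k := by
        refine norm_sum_le_of_le _ fun j _ => ?_
        rw [coeff_X_pow_add_sum, ← sub_mul, norm_mul, norm_pow, hx, norm_sub_rev]
        exact mul_le_mul (hcoeff j) (pow_le_pow_right₀ hb j.isLt.le) (by positivity)
          (by positivity)
    _ = (1 / 2 : ℝ) ^ (M * (n + b + 1)) * (1 / 2) ^ (k * n) *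
        (((1 / 2) ^ (k * b) * (2 ^ b) ^ k) * (k * (1 / 2) ^ k)) := by
        rw [Finset.sum_const, Finset.card_univ, Fintype.card_fin, nsmul_eq_mul]
        ring
    _ ≤ (1 / 2 : ℝ) ^ (M * (n + b + 1)) := by
        have h1 : ((1 / 2 : ℝ) ^ (k * b) * (2 ^ b) ^ k) = 1 := by
          rw [← pow_mul, mul_comm b k, ← mul_pow]; norm_num
        have h2 : (k : ℝ) * (1 / 2) ^ k ≤ 1 := by
          have : (k : ℝ) ≤ 2 ^ k := by exact_mod_cast Nat.lt_two_pow_self.le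
          rw [one_div, inv_pow, ← div_eq_mul_inv, div_le_one (by positivity)]
          exact this
        rw [h1, one_mul]
        have h3 : (1 / 2 : ℝ) ^ (k * n) ≤ 1 := pow_le_one₀ (by norm_num) (by norm_num)
        rw [mul_assoc]
        exact mul_le_of_le_one_right (by positivity) (mul_le_one₀ h3 (by positivity) h2)

/-! ### Computing the roots of a polynomial -/

open Polynomial in
theorem exists_roots {k : ℕ} (a : Fin k → ℂ) :
    ∃ r : Fin k → ℂ, X ^ k + ∑ i : Fin k, C (a i) * X ^ (i : ℕ) = ∏ i, (X - C (r i)) := by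
  have hlt := degree_sum_fin_lt a
  set P : ℂ[X] := X ^ k + ∑ i : Fin k, C (a i) * X ^ (i : ℕ) with hP
  have hmonic : P.Monic := monic_X_pow_add hlt
  have hdeg : P.natDegree = k := natDegree_eq_of_degree_eq_some <|
    (degree_add_eq_left_of_degree_lt (by rwa [degree_X_pow])).trans (degree_X_pow k)
  have hs := IsAlgClosed.splits P
  obtain ⟨l, hl⟩ := Quot.exists_rep P.roots
  have hlen : l.length = k := by
    rw [← hdeg, hs.natDegree_eq_card_roots, ← hl]
    rfl
  refine ⟨fun i => l.get (i.cast hlen.symm), ?_⟩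
  rw [hs.eq_prod_roots_of_monic hmonic, ← hl]
  clear_value P
  subst hlen
  simp [← List.prod_ofFn, List.ofFn_getElem_eq_map l fun x => X - C x]

/-- The open square of side length `2 * ε` around the origin. -/
def InBox (z : ℂ) (ε : ℝ) : Prop := |z.re| < ε ∧ |z.im| < ε

theorem InBox.norm_le {z : ℂ} {ε : ℝ} (h : InBox z ε) : ‖z‖ ≤ 2 * ε := by
  linarith [Complex.norm_le_abs_re_add_abs_im z, h.1, h.2]

theorem InBox.of_norm_lt {z : ℂ} {ε : ℝ} (h : ‖z‖ < ε) : InBox z ε :=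
  ⟨(Complex.abs_re_le_norm z).trans_lt h, (Complex.abs_im_le_norm z).trans_lt h⟩

theorem InBox.eventually {X : Type*} [TopologicalSpace X] {f : X → ℂ} (hf : Continuous f) {ε : ℝ}
    {x : X} (h : InBox (f x) ε) : ∀ᶠ y in nhds x, InBox (f y) ε :=
  ((Complex.continuous_re.comp hf).abs.continuousAt.eventually_lt_const h.1).and
    ((Complex.continuous_im.comp hf).abs.continuousAt.eventually_lt_const h.2)

/-- Boxes replace discs so that the test needs only rational arithmetic, without square roots. -/
theorem PrimrecComplex.primrecPred_inBox {f : ℕ → ℂ} {ε : ℕ → ℝ} (hf : PrimrecComplex f)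
    (hε : PrimrecReal ε) : PrimrecPred fun n => InBox (f n) (ε n) :=
  (hf.1.primrecPred_abs_lt hε).and (hf.2.primrecPred_abs_lt hε)

/-- Where a name of a tuple of complex numbers says whether `j` is the code of the `N`-th
approximation of the real (`e = 0`) or imaginary (`e = 1`) part of the `i`-th entry. -/
def namePosition (k i e N j : ℕ) : ℕ := k * (2 * Nat.pair N j + e) + i

theorem exists_approximation {k : ℕ} {p : BinSeq} {a : Fin k → ℂ}
    (h : (complexRep.pow k).names p a) (i : Fin k) (N : ℕ) :
    ∃ u v, (∀ j, p (namePosition k i 0 N j) = true ↔ u = j) ∧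
      (∀ j, p (namePosition k i 1 N j) = true ↔ v = j) ∧
      InBox (⟨(ratOfNat u : ℚ), (ratOfNat v : ℚ)⟩ - a i) ((1 / 2) ^ N) := by
  obtain ⟨m, hm, hre⟩ := h i 0
  obtain ⟨m', hm', him⟩ := h i 1
  exact ⟨m N, m' N, hm N, hm' N, hre N, him N⟩

/-- The precision to which the coefficients are approximated in the `y`-th step. -/
def stepPrecision (M y b : ℕ) : ℕ := M * (y + 2 + (b + 3) + 1) + 2 + y

open Polynomial in
/-- The condition on the `y`-th approximation `c'` to the roots, when `c` is the previous one, and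
`z` is an approximation to the coefficients. -/
def RootTest (M k y c b c' z : ℕ) : Prop :=
  ∀ i : Fin k, InBox (gaussEntry z i) b ∧ InBox (gaussEntry c' i) b ∧
    InBox ((∏ l : Fin k, (X - C (gaussEntry c' l))).coeff i - gaussEntry z i)
      ((1 / 2) ^ stepPrecision M y b) ∧
    (y = 0 ∨ InBox (gaussEntry c' i - gaussEntry c i) ((1 / 2) ^ y))

/-- `z` approximates the tuple named by `p` with precision `N`. -/
def NameTest (k : ℕ) (p : BinSeq) (N z : ℕ) : Prop :=
  ∀ i : Fin k, p (namePosition k i 0 N (natEntry z (2 * i))) = true ∧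
    p (namePosition k i 1 N (natEntry z (2 * i + 1))) = true

theorem NameTest.inBox {k : ℕ} {p : BinSeq} {a : Fin k → ℂ} (h : (complexRep.pow k).names p a)
    {N z : ℕ} (hz : NameTest k p N z) (i : Fin k) :
    InBox (gaussEntry z i - a i) ((1 / 2) ^ N) := by
  obtain ⟨u, v, hu, hv, hbox⟩ := exists_approximation h i N
  obtain rfl := (hu _).1 (hz i).1
  obtain rfl := (hv _).1 (hz i).2
  exact hbox

theorem exists_nameTest {k : ℕ} {p : BinSeq} {a : Fin k → ℂ} (h : (complexRep.pow k).names p a)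
    (N : ℕ) : ∃ z, NameTest k p N z := by
  choose u v hu hv _ using fun i => exists_approximation h i N
  obtain ⟨z, hz⟩ := exists_natEntry_pair_eq fun i => (u i, v i)
  exact ⟨z, fun i => ⟨(hu i _).2 (hz i).1.symm, (hv i _).2 (hz i).2.symm⟩⟩

open Polynomial in
theorem exists_rootTest (M : ℕ) {k : ℕ} {p : BinSeq} {a r : Fin k → ℂ}
    (h : (complexRep.pow k).names p a)
    (hr : X ^ k + ∑ i : Fin k, C (a i) * X ^ (i : ℕ) = ∏ i, (X - C (r i))) {y c : ℕ}
    (hc : y = 0 ∨ ∀ i : Fin k, ‖r i - gaussEntry c i‖ < (1 / 2 : ℝ) ^ y) :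
    ∃ b c' z, RootTest M k y c b c' z ∧ NameTest k p (stepPrecision M y b) z := by
  obtain ⟨b, hb⟩ := exists_nat_gt (∑ i, (‖a i‖ + ‖r i‖) + 2)
  have hb' (i : Fin k) : ‖a i‖ + ‖r i‖ + 2 < b := by
    have := Finset.single_le_sum (f := fun i => ‖a i‖ + ‖r i‖) (fun i _ => by positivity)
      (Finset.mem_univ i)
    linarith
  obtain ⟨z, hz⟩ := exists_nameTest h (stepPrecision M y b)
  have hzbox := hz.inBox h
  -- The true roots `r` satisfy these conditions and the conditions are open, so density provides a
  -- Gaussian rational solution.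
  have hev : ∀ᶠ d in nhds r, ∀ i : Fin k, InBox (d i) b ∧
      InBox ((∏ l, (X - C (d l))).coeff i - gaussEntry z i) ((1 / 2) ^ stepPrecision M y b) ∧
      (y = 0 ∨ InBox (d i - gaussEntry c i) ((1 / 2) ^ y)) := by
    refine Filter.eventually_all.2 fun i => Filter.Eventually.and ?_ (Filter.Eventually.and ?_ ?_)
    · refine InBox.eventually (continuous_apply i) (.of_norm_lt ?_)
      linarith [hb' i, norm_nonneg (a i)]
    · refine InBox.eventually (f := fun d : Fin k → ℂ => (∏ l, (X - C (d l))).coeff i - gaussEntry z i)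
        ((continuous_coeff_prod_X_sub_C Finset.univ i).sub continuous_const) ?_
      rw [← hr, coeff_X_pow_add_sum]
      have := hzbox i
      simpa [InBox, abs_sub_comm] using this
    · rcases hc with hc | hc
      · exact .of_forall fun _ => .inl hc
      · exact (InBox.eventually (f := fun d : Fin k → ℂ => d i - gaussEntry c i)
          ((continuous_apply i).sub continuous_const) (.of_norm_lt (hc i))).mono fun _ => .inr
  obtain ⟨t, ht, hto, hrt⟩ := eventually_nhds_iff.1 hev
  obtain ⟨c', hc'⟩ := (denseRange_gaussEntry k).exists_mem_open hto ⟨r, hrt⟩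
  refine ⟨b, c', z, fun i => ⟨?_, ht _ hc' i⟩, hz⟩
  have h1 : (1 / 2 : ℝ) ^ stepPrecision M y b ≤ 1 := pow_le_one₀ (by norm_num) (by norm_num)
  have h2 := norm_le_norm_add_norm_sub (a i) (gaussEntry z i)
  have h3 := (hzbox i).norm_le
  rw [norm_sub_rev] at h2
  refine .of_norm_lt ?_
  have := norm_sub_rev (a i) (gaussEntry z i)
  linarith [hb' i, norm_nonneg (r i)]

open Polynomial in
theorem exists_rootTest_sound (k : ℕ) :
    ∃ M, ∀ {p : BinSeq} {a : Fin k → ℂ}, (complexRep.pow k).names p a → ∀ {y c b c' z : ℕ},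
      RootTest M k y c b c' z → NameTest k p (stepPrecision M y b) z →
      (∀ j : Fin k, ‖(∏ l : Fin k, (X - C (gaussEntry c' l))).coeff j - a j‖ ≤ (1 / 2 : ℝ) ^ y) ∧
      ∃ r : Fin k → ℂ, X ^ k + ∑ i : Fin k, C (a i) * X ^ (i : ℕ) = ∏ i, (X - C (r i)) ∧
        ∀ i, ‖r i - gaussEntry c' i‖ ≤ (1 / 2 : ℝ) ^ (y + 2) := by
  obtain ⟨M, hM⟩ := exists_perm_norm_sub_le_of_coeff k
  refine ⟨M, fun {p a} h y c b c' z ht hz => ?_⟩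
  have hzbox := hz.inBox h
  -- In `stepPrecision`, the summand `2` absorbs the factor `4` from two box errors, and `y` makes
  -- the coefficient errors tend to zero.
  have hcoeff (j : Fin k) : ‖(∏ l : Fin k, (X - C (gaussEntry c' l))).coeff j - a j‖ ≤
      (1 / 2 : ℝ) ^ (M * (y + 2 + (b + 3) + 1)) * (1 / 2) ^ y := by
    have h1 := (ht j).2.2.1.norm_le
    have h2 := (hzbox j).norm_le
    refine (norm_sub_le_norm_sub_add_norm_sub _ (gaussEntry z j) _).trans ?_
    refine (add_le_add h1 h2).trans_eq ?_
    rw [stepPrecision, pow_add, pow_add _ _ 2]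
    ring
  have hle (n : ℕ) : (1 / 2 : ℝ) ^ n ≤ 1 := pow_le_one₀ (by norm_num) (by norm_num)
  refine ⟨fun j => (hcoeff j).trans (mul_le_of_le_one_left (by positivity) (hle _)), ?_⟩
  have hbpow : (b : ℝ) + 1 ≤ 2 ^ b := by exact_mod_cast Nat.lt_two_pow_self
  -- The exponent `b + 3` leaves room for both bounds: coefficients up to `2 * b + 2` and
  -- approximate roots up to `2 * b`.
  have hbpow' : (8 : ℝ) * (b + 1) ≤ 2 ^ (b + 3) := by rw [pow_add]; linarith
  have hb0 : (0 : ℝ) ≤ b := b.cast_nonneg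
  obtain ⟨r, hr⟩ := exists_roots a
  obtain ⟨σ, hσ⟩ := hM (b + 3) (y + 2) a r (fun i => gaussEntry c' i) hr
    (fun i => by
      have h1 := (ht i).1.norm_le
      have h2 := (hzbox i).norm_le
      have h3 := norm_le_norm_add_norm_sub (gaussEntry z i) (a i)
      have := hle (stepPrecision M y b)
      have := norm_sub_rev (a i) (gaussEntry z i)
      linarith)
    (fun i => by
      have := (ht i).2.1.norm_le
      linarith)
    (fun j => (hcoeff j).trans (mul_le_of_le_one_right (by positivity) (hle _)))
  exact ⟨fun i => r (σ i), hr.trans (Equiv.prod_comp σ fun i => X - C (r i)).symm, hσ⟩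

theorem decidableFunctional_step (k M : ℕ) {y c b c' z : ℕ → ℕ} (hy : Primrec y) (hc : Primrec c)
    (hb : Primrec b) (hc' : Primrec c') (hz : Primrec z) :
    DecidableFunctional fun p n => RootTest M k (y n) (c n) (b n) (c' n) (z n) ∧
      NameTest k p (stepPrecision M (y n) (b n)) (z n) := by
  have s {u v : ℕ → ℕ} (hu : Primrec u) (hv : Primrec v) : Primrec fun n => u n + v n :=
    Primrec.nat_add.comp hu hv
  have m {u v : ℕ → ℕ} (hu : Primrec u) (hv : Primrec v) : Primrec fun n => u n * v n :=
    Primrec.nat_mul.comp hu hv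
  have hN : Primrec fun n => stepPrecision M (y n) (b n) :=
    s (s (m (.const M) (s (s (s hy (.const 2)) (s hb (.const 3))) (.const 1))) (.const 2)) hy
  have hpos (i : Fin k) (e l : ℕ) : Primrec fun n =>
      namePosition k i e (stepPrecision M (y n) (b n)) (natEntry (z n) l) :=
    s (m (.const k) (s (m (.const 2) (Primrec₂.natPair.comp hN
      (primrec_natEntry hz (.const l)))) (.const e))) (.const _)
  refine DecidableFunctional.and (.forall_fintype fun i => ?_) (.forall_fintype fun i => ?_)
  · have hg := primrecComplex_gaussEntry hz i
    have hg' := primrecComplex_gaussEntry hc' i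
    refine .of_primrecPred ((hg.primrecPred_inBox (.natCast hb)).and
      ((hg'.primrecPred_inBox (.natCast hb)).and (PrimrecPred.and ?_ (PrimrecPred.or ?_ ?_))))
    · exact ((PrimrecComplex.coeff_prod_X_sub_C Finset.univ
        (fun l : Fin k => primrecComplex_gaussEntry hc' l) i).sub hg).primrecPred_inBox (.half_pow hN)
    · exact Primrec.eq.comp hy (.const 0)
    · exact (hg'.sub (primrecComplex_gaussEntry hc i)).primrecPred_inBox (.half_pow hy)
  · exact .and (.oracle (hpos i 0 _)) (.oracle (hpos i 1 _))

/-- The tail after index `n + 1` sums to at most `(1 / 2) ^ (n + 1)`; the shift by one gives the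
strict inequality required of a name. -/
theorem exists_limit_of_abs_sub_lt {f : ℕ → ℝ}
    (hf : ∀ n, |f (n + 1) - f n| < (1 / 2) ^ (n + 1)) :
    ∃ x, Filter.Tendsto f Filter.atTop (nhds x) ∧ ∀ n, |f (n + 1) - x| < (1 / 2) ^ n := by
  have hd (n : ℕ) : dist (f n) (f (n + 1)) ≤ 1 / 2 / 2 ^ n := by
    rw [dist_comm, Real.dist_eq]
    refine (hf n).le.trans_eq ?_
    rw [pow_succ, one_div_pow]
    ring
  obtain ⟨x, hx⟩ := cauchySeq_tendsto_of_complete (cauchySeq_of_le_geometric_two hd)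
  refine ⟨x, hx, fun n => ?_⟩
  have := dist_le_of_le_geometric_two_of_tendsto hd hx (n + 1)
  rw [Real.dist_eq] at this
  refine this.trans_lt ?_
  rw [one_div_pow]
  exact one_div_lt_one_div_of_lt (by positivity) (pow_lt_pow_right₀ (by norm_num) n.lt_succ_self)

open Polynomial in
theorem exists_rootApproximation (k : ℕ) :
    ∃ Φ, PartrecFunctional Φ ∧ ∀ p (a : Fin k → ℂ), (complexRep.pow k).names p a →
      ∃ s : ℕ → ℕ, (∀ n, Φ p n = Part.some (s n)) ∧
        ∃ r : Fin k → ℂ, X ^ k + ∑ i : Fin k, C (a i) * X ^ (i : ℕ) = ∏ i, (X - C (r i)) ∧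
          ∀ (i : Fin k) (n : ℕ), InBox (gaussEntry (s (n + 2)) i - r i) ((1 / 2) ^ n) := by
  obtain ⟨M, hM⟩ := exists_rootTest_sound k
  have hfst {f : ℕ → ℕ} := @PrimrecReal.unpair_fst f
  have hsnd {f : ℕ → ℕ} := @PrimrecReal.unpair_snd f
  have hid : Primrec fun n : ℕ => n := Primrec.id
  have hg := hfst (hsnd hid)
  obtain ⟨Φ, hΦ, hseq⟩ := (decidableFunctional_step k M (hfst (hfst hid)) (hsnd (hfst hid))
    (hfst (hsnd hid)) (hfst (hsnd (hsnd hid))) (hsnd (hsnd (hsnd hid)))).exists_sequence hg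
  refine ⟨Φ, hΦ, fun p a h => ?_⟩
  -- The initial code `0` approximates nothing, so the invariant is empty at `n = 0`. The
  -- arrangement `r` is quantified inside it and may vary with `n`.
  obtain ⟨s, hs, hstep⟩ := hseq p (fun n c => n = 0 ∨ ∃ r : Fin k → ℂ,
      X ^ k + ∑ i : Fin k, C (a i) * X ^ (i : ℕ) = ∏ i, (X - C (r i)) ∧
        ∀ i : Fin k, ‖r i - gaussEntry c i‖ ≤ (1 / 2 : ℝ) ^ (n + 1)) (.inl rfl)
    (fun n c hI => by
      have hex : ∃ r : Fin k → ℂ,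
          X ^ k + ∑ i : Fin k, C (a i) * X ^ (i : ℕ) = ∏ i, (X - C (r i)) ∧
          (n = 0 ∨ ∀ i : Fin k, ‖r i - gaussEntry c i‖ < (1 / 2 : ℝ) ^ n) := by
        rcases hI with rfl | ⟨r, hr, hc⟩
        · obtain ⟨r, hr⟩ := exists_roots a
          exact ⟨r, hr, .inl rfl⟩
        · exact ⟨r, hr, .inr fun i => (hc i).trans_lt
            (pow_lt_pow_right_of_lt_one₀ (by norm_num) (by norm_num) n.lt_succ_self)⟩
      obtain ⟨r, hr, hc⟩ := hex
      obtain ⟨b, c', z, hw⟩ := exists_rootTest M h hr hc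
      refine ⟨Nat.pair b (Nat.pair c' z), ?_⟩
      simpa only [Nat.unpair_pair] using hw)
    (fun n c w _ hw => by
      simp only [Nat.unpair_pair] at hw
      exact .inr (hM h hw.1 hw.2).2)
  simp only [Nat.unpair_pair] at hstep
  have hclose (n : ℕ) (i : Fin k) :
      InBox (gaussEntry (s (n + 2)) i - gaussEntry (s (n + 1)) i) ((1 / 2) ^ (n + 1)) := by
    obtain ⟨w, hw, hsw⟩ := hstep (n + 1)
    rw [hsw]
    exact (hw.1 i).2.2.2.resolve_left (by omega)
  have hcoeff (n : ℕ) (j : Fin k) :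
      ‖(∏ l : Fin k, (X - C (gaussEntry (s (n + 1)) l))).coeff j - a j‖ ≤ (1 / 2 : ℝ) ^ n := by
    obtain ⟨w, hw, hsw⟩ := hstep n
    rw [hsw]
    exact (hM h hw.1 hw.2).1 j
  choose x hx hxs using fun i : Fin k => exists_limit_of_abs_sub_lt
    (f := fun n => (gaussEntry (s (n + 1)) i).re) fun n => (hclose n i).1
  choose x' hx' hxs' using fun i : Fin k => exists_limit_of_abs_sub_lt
    (f := fun n => (gaussEntry (s (n + 1)) i).im) fun n => (hclose n i).2
  refine ⟨s, hs, fun i => ⟨x i, x' i⟩, ?_, fun i n => ⟨hxs i n, hxs' i n⟩⟩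
  have hlim : Filter.Tendsto (fun n => fun i : Fin k => gaussEntry (s (n + 1)) i) Filter.atTop
      (nhds fun i => ⟨x i, x' i⟩) :=
    tendsto_pi_nhds.2 fun i =>
      (Complex.equivRealProdCLM.symm.continuous.tendsto (x i, x' i)).comp
        ((hx i).prodMk_nhds (hx' i))
  have hlimcoeff (j : Fin k) :
      (∏ l : Fin k, (X - C (⟨x l, x' l⟩ : ℂ))).coeff j = a j := by
    refine tendsto_nhds_unique
      (((continuous_coeff_prod_X_sub_C Finset.univ j).tendsto _).comp hlim) ?_
    exact tendsto_iff_norm_sub_tendsto_zero.2 (squeeze_zero (fun _ => norm_nonneg _)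
      (fun n => hcoeff n j) (tendsto_pow_atTop_nhds_zero_of_lt_one (by norm_num) (by norm_num)))
  refine Polynomial.funext fun z => ?_
  have := eval_prod_X_sub_C_eq (fun i => ⟨x i, x' i⟩) z
  simp only [hlimcoeff] at this
  simpa [eval_prod, eval_finsetSum] using this.symm

open Polynomial in
theorem exists_computable_roots (k : ℕ) :
    ∃ Φ, PartrecFunctional Φ ∧ ∀ p (a : Fin k → ℂ), (complexRep.pow k).names p a →
      ∃ r : Fin k → ℂ, X ^ k + ∑ i : Fin k, C (a i) * X ^ (i : ℕ) = ∏ i, (X - C (r i)) ∧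
        ∃ q, (complexRep.pow k).names q r ∧ ∀ n, Φ p n = Part.some (q n).toNat := by
  obtain ⟨Φ, hΦ, hs⟩ := exists_rootApproximation k
  have hid : Primrec fun n : ℕ => n := Primrec.id
  have hdiv {f : ℕ → ℕ} (hf : Primrec f) (d : ℕ) : Primrec fun n => f n / d :=
    Primrec.nat_div.comp hf (.const d)
  have hmod {f : ℕ → ℕ} (hf : Primrec f) (d : ℕ) : Primrec fun n => f n % d :=
    Primrec.nat_mod.comp hf (.const d)
  -- This inverts `namePosition`: for `t = k * (2 * ⟨N, j⟩ + e) + i`, the entry is `t % k`, the part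
  -- `t / k % 2`, and `⟨N, j⟩` is `t / k / 2`. For `k = 0` every sequence is a name, so the default
  -- values do no harm.
  have hidx : Primrec fun t => (t / k / 2).unpair.1 + 2 :=
    Primrec.nat_add.comp (PrimrecReal.unpair_fst (hdiv (hdiv hid k) 2)) (.const 2)
  -- Here `v` pairs the position `t` with the code `s (N + 2)`.
  have htest : PrimrecPred fun v : ℕ =>
      natEntry v.unpair.2 (2 * (v.unpair.1 % k) + v.unpair.1 / k % 2) =
        (v.unpair.1 / k / 2).unpair.2 := by
    have h1 := PrimrecReal.unpair_fst hid
    exact Primrec.eq.comp (primrec_natEntry (PrimrecReal.unpair_snd hid)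
      (Primrec.nat_add.comp (Primrec.nat_mul.comp (.const 2) (hmod h1 k)) (hmod (hdiv h1 k) 2)))
      (PrimrecReal.unpair_snd (hdiv (hdiv h1 k) 2))
  have hout : ComputableFunctional fun _ (v : ℕ) =>
      if natEntry v.unpair.2 (2 * (v.unpair.1 % k) + v.unpair.1 / k % 2) =
        (v.unpair.1 / k / 2).unpair.2 then 1 else 0 :=
    .of_primrec (Primrec.ite htest (.const 1) (.const 0))
  refine ⟨_, PartrecFunctional.comp hout (PartrecFunctional.pair
    (ComputableFunctional.of_primrec hid)
    (PartrecFunctional.comp hΦ (ComputableFunctional.of_primrec hidx))), fun p a h => ?_⟩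
  obtain ⟨s, hΦs, r, hr, hbox⟩ := hs p a h
  refine ⟨r, hr, fun t => decide (natEntry (s ((t / k / 2).unpair.1 + 2))
    (2 * (t % k) + t / k % 2) = (t / k / 2).unpair.2), fun i => ?_, fun t => ?_⟩
  · have hk := i.pos
    have hm (m : ℕ) : (k * m + i) % k = i := by
      rw [Nat.mul_add_mod, Nat.mod_eq_of_lt i.isLt]
    have hd (m : ℕ) : (k * m + i) / k = m := by
      rw [Nat.mul_add_div hk, Nat.div_eq_of_lt i.isLt, add_zero]
    intro e
    have he (m : ℕ) : (2 * m + e) / 2 = m := by omega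
    have he' (m : ℕ) : (2 * m + e) % 2 = e := by omega
    refine ⟨fun n => natEntry (s (n + 2)) (2 * i + e), fun n j => ?_, fun n => ?_⟩
    · simp only [hm, hd, he, he', Nat.unpair_pair, decide_eq_true_eq]
    · fin_cases e
      · exact (hbox i n).1
      · exact (hbox i n).2
  · have e1 : (Part.some ((t / k / 2).unpair.1 + 2) >>= Φ p) =
        Part.some (s ((t / k / 2).unpair.1 + 2)) := (Part.bind_some _ _).trans (hΦs _)
    rw [e1]
    simp only [Seq.seq, Part.map_eq_map, Part.map_some, Part.bind_eq_bind, Part.bind_some,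
      Nat.unpair_pair, Bool.toNat, Bool.cond_decide]

theorem theorem7 (k : ℕ) :
    ∃ Roots : (Fin k → ℂ) → UnorderedTuple ℂ k,
      (∀ a c : Fin k → ℂ, Roots a = UnorderedTuple.mk c ↔
        (Polynomial.X ^ k + ∑ i : Fin k, Polynomial.C (a i) * Polynomial.X ^ (i : ℕ) :
            Polynomial ℂ) =
          ∏ i : Fin k, (Polynomial.X - Polynomial.C (c i))) ∧
      IsComputableMap (complexRep.pow k) (complexRep.unordered k) Roots := by
  choose r hr using fun a : Fin k → ℂ => exists_roots a
  have hiff (a c : Fin k → ℂ) : UnorderedTuple.mk (r a) = UnorderedTuple.mk c ↔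
      (Polynomial.X ^ k + ∑ i : Fin k, Polynomial.C (a i) * Polynomial.X ^ (i : ℕ) :
          Polynomial ℂ) = ∏ i : Fin k, (Polynomial.X - Polynomial.C (c i)) := by
    rw [hr a, prod_X_sub_C_eq_iff]
    exact Quotient.eq
  obtain ⟨Φ, hΦ, h⟩ := exists_computable_roots k
  refine ⟨fun a => UnorderedTuple.mk (r a), hiff, Φ, hΦ, fun p a ha => ?_⟩
  obtain ⟨c, hc, q, hq, hΦq⟩ := h p a ha
  exact ⟨q, ⟨c, hq, ((hiff a c).2 hc).symm⟩, hΦq⟩
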